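/- Let $n, m \ge 1$ be integers and let $1 < p_1, \dots, p_m < \infty$. Let $\mathbb B = \{x \in \mathbb R^n : |x| < 1\}$, let $\mathbb S = \partial \mathbb B$, and let $\sigma$ be the normalized surface measure on $\mathbb S$. For $1<p<\infty$ the harmonic Hardy space $H^p(\mathbb B)$ consists of all (real- or complex-valued) harmonic functions $f$ on $\mathbb B$ with $$\|f\|_{H^p(\mathbb B)} = \sup_{0 \le r < 1} \left( \int_{\mathbb S} |f(r\xi)|^p \, d\sigma(\xi) \right)^{1/p} < \infty .$$ Let $\mathbb H = \{(x,t) : x \in \mathbb R^n,\ t > 0\} \subset \mathbb R^{n+1}$. The harmonic Hardy space $H^p(\mathbb H)$ consists of all (real- or complex-valued) harmonic functions $f$ on $\mathbb H$ with $$\|f\|_{H^p(\mathbb H)} = \sup_{t > 0} \left( \int_{\mathbb R^n} |f(x,t)|^p \, dx \right)^{1/p} < \infty .$$ Then there is a constant $C < \infty$, depending only on $n$, $m$ and $p_1, \dots, p_m$, such that the following hold. 1. If $f_j \in H^{p_j}(\mathbb B)$ for $j = 1, \dots, m$, then for all $0 \le r < 1$ $$\int_{\mathbb S} \prod_{j=1}^m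 |f_j(r\xi)|^{p_j} \, d\sigma(\xi)\,(1-r)^{(m-1)n} \le C \prod_{j=1}^m \|f_j\|_{H^{p_j}(\mathbb B)}^{p_j}.$$ 2. If $f_j \in H^{p_j}(\mathbb H)$ for $j = 1, \dots, m$, then for all $t > 0$ $$\int_{\mathbb R^n} \prod_{j=1}^m |f_j(x,t)|^{p_j} \, dx \; t^{(m-1)n} \le C \prod_{j=1}^m \|f_j\|_{H^{p_j}(\mathbb H)}^{p_j}.$$ -/

import Mathlib

open MeasureTheory InnerProductSpace
open scoped ENNReal NNReal

noncomputable section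

/-- `ℝⁿ` with its Euclidean norm. -/
abbrev RealSpace (n : ℕ) : Type := EuclideanSpace ℝ (Fin n)

/-- `ℝⁿ⁺¹ = ℝⁿ × ℝ` with its Euclidean norm; its points are written `(x, t)`. -/
abbrev RealSpaceSucc (n : ℕ) : Type := WithLp 2 (RealSpace n × ℝ)

/-- The open unit ball of `ℝⁿ`. -/
def unitBall (n : ℕ) : Set (RealSpace n) := Metric.ball 0 1

/-- The unit sphere of `ℝⁿ`. -/
abbrev UnitSphere (n : ℕ) : Type := Metric.sphere (0 : RealSpace n) 1

/-- The upper half space `{(x, t) : x ∈ ℝⁿ, t > 0}` of `ℝⁿ⁺¹`. -/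
def upperHalfSpace (n : ℕ) : Set (RealSpaceSucc n) := {z | 0 < z.snd}

/-- The normalized (rotation invariant, total mass one) surface measure on the unit sphere. -/
def sphereMeasure (n : ℕ) : Measure (UnitSphere n) :=
  ((volume : Measure (RealSpace n)).toSphere Set.univ)⁻¹ •
    (volume : Measure (RealSpace n)).toSphere

variable {𝕜 : Type*} [RCLike 𝕜]

/-- The Hardy norm on the ball,
`‖f‖ = sup_{0 ≤ r < 1} (∫_𝕊 |f(rξ)|^p dσ(ξ))^{1/p}`, with values in `[0, ∞]`. -/
def ballHardyNorm (n : ℕ) (p : ℝ) (f : RealSpace n → 𝕜) : ℝ≥0∞ :=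
  ⨆ r ∈ Set.Ico (0 : ℝ) 1,
    (∫⁻ ξ : UnitSphere n, ‖f (r • (ξ : RealSpace n))‖ₑ ^ p ∂(sphereMeasure n)) ^ (1 / p)

/-- Membership in the harmonic Hardy space of the ball. Only the values of `f` on the ball
matter. -/
def MemBallHardy (n : ℕ) (p : ℝ) (f : RealSpace n → 𝕜) : Prop :=
  HarmonicOnNhd f (unitBall n) ∧ ballHardyNorm n p f < ∞

/-- The Hardy norm on the upper half space,
`‖f‖ = sup_{t > 0} (∫_{ℝⁿ} |f(x, t)|^p dx)^{1/p}`, with values in `[0, ∞]`. -/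
def halfSpaceHardyNorm (n : ℕ) (p : ℝ) (f : RealSpaceSucc n → 𝕜) : ℝ≥0∞ :=
  ⨆ t ∈ Set.Ioi (0 : ℝ),
    (∫⁻ x : RealSpace n, ‖f (WithLp.toLp 2 (x, t))‖ₑ ^ p) ^ (1 / p)

/-- Membership in the harmonic Hardy space of the upper half space. Only the values of `f` on
the half space matter. -/
def MemHalfSpaceHardy (n : ℕ) (p : ℝ) (f : RealSpaceSucc n → 𝕜) : Prop :=
  HarmonicOnNhd f (upperHalfSpace n) ∧ halfSpaceHardyNorm n p f < ∞

end

/-! A function of finite Hardy norm satisfies a pointwise bound `‖f x‖ ^ p * d ^ n ≤ A * N ^ p`,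
where `d` is the distance from `x` to the boundary and `N` is the norm. In the product, all factors
but one are estimated this way, giving `d ^ ((m - 1) * n)`; the remaining factor is integrated over
the slice, where the Hardy norm bounds it (`lintegral_prod_mul_pow_le`).

The pointwise bound combines a weighted mean value property with Hölder on a solid ball of radius `d
/ 2` (`exists_enorm_rpow_le_setLIntegral`). The solid integral is then bounded slice by slice: over
the unit ball in polar coordinates, or over a slab of thickness `t` by Fubini. In the half space the
ball has volume of order `t ^ (n + 1)` and the slab contributes a factor `t`, which leaves `t ^ n`.
-/

/-! ### Weighted mean value property of harmonic functions. -/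

section MeanValue

variable {E F : Type*} [NormedAddCommGroup E]

theorem hasDerivAt_max_zero_sq (u : ℝ) :
    HasDerivAt (fun u : ℝ => max u 0 ^ 2) (2 * max u 0) u := by
  rcases lt_trichotomy u 0 with h | rfl | h
  · rw [max_eq_right h.le, mul_zero]
    refine (hasDerivAt_const u (0 : ℝ)).congr_of_eventuallyEq ?_
    filter_upwards [Iio_mem_nhds h] with v hv
    simp [max_eq_right (Set.mem_Iio.1 hv).le]
  · rw [hasDerivAt_iff_isLittleO_nhds_zero]
    have h1 : (fun h : ℝ => max (0 + h) 0 ^ 2 - max 0 0 ^ 2 - h • (2 * max (0 : ℝ) 0))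
        =O[nhds 0] fun h : ℝ => h ^ 2 := by
      refine Asymptotics.IsBigO.of_norm_le fun h => ?_
      rcases le_total h 0 with h0 | h0 <;> simp [h0, sq_nonneg]
    exact h1.trans_isLittleO (Asymptotics.isLittleO_pow_id one_lt_two)
  · rw [max_eq_left h.le]
    refine (by simpa using hasDerivAt_pow 2 u : HasDerivAt (fun v : ℝ => v ^ 2) (2 * u) u)
      |>.congr_of_eventuallyEq ?_
    filter_upwards [Ioi_mem_nhds h] with v hv
    simp [max_eq_left (Set.mem_Ioi.1 hv).le]

/-- The radial weight `(1 - ‖y‖²)₊`. -/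
def ballWeight (y : E) : ℝ := max (1 - ‖y‖ ^ 2) 0

theorem continuous_ballWeight : Continuous (ballWeight : E → ℝ) := by
  unfold ballWeight; fun_prop

theorem ballWeight_nonneg (y : E) : 0 ≤ ballWeight y := le_max_right _ _

theorem ballWeight_le_one (y : E) : ballWeight y ≤ 1 :=
  max_le (by nlinarith [sq_nonneg ‖y‖]) zero_le_one

theorem ballWeight_eq_zero {y : E} (hy : y ∉ Metric.closedBall (0 : E) 1) : ballWeight y = 0 := by
  rw [mem_closedBall_zero_iff, not_le] at hy
  exact max_eq_right (by nlinarith)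

variable [InnerProductSpace ℝ E] [NormedAddCommGroup F] [NormedSpace ℝ F]

/-- With `w` the weight, the field `w(y) y` is the gradient of `-w² / 4`; this is what lets a radial
derivative be integrated by parts. Squaring makes the weight differentiable across the unit sphere.
-/
theorem hasFDerivAt_ballWeight_sq (y : E) :
    HasFDerivAt (fun y : E => ballWeight y ^ 2) (-(4 * ballWeight y) • innerSL ℝ y) y := by
  have h1 : HasFDerivAt (fun y : E => 1 - ‖y‖ ^ 2) (-(2 • innerSL ℝ y)) y :=
    ((hasStrictFDerivAt_norm_sq y).hasFDerivAt).const_sub 1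
  have h2 := (hasDerivAt_max_zero_sq (1 - ‖y‖ ^ 2)).comp_hasFDerivAt y h1
  refine h2.congr_fderiv ?_
  ext v
  simp [ballWeight]
  ring

variable [FiniteDimensional ℝ E]

theorem hasCompactSupport_ballWeight : HasCompactSupport (ballWeight : E → ℝ) :=
  HasCompactSupport.intro (isCompact_closedBall 0 1) fun _ => ballWeight_eq_zero

variable [MeasurableSpace E] [BorelSpace E] (μ : Measure E) [μ.IsAddHaarMeasure]

theorem integral_ballWeight_pos : 0 < ∫ y, ballWeight y ∂μ := by
  refine (continuous_ballWeight.integral_pos_of_hasCompactSupport_nonneg_nonzero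
    hasCompactSupport_ballWeight ballWeight_nonneg (x := 0) ?_)
  simp [ballWeight]

/-- The integral is the derivative in `s` of the weighted mean of `g` over the ball of radius `s`.
Integration by parts along an orthonormal basis turns it into `s / 4` times the integral of `w² Δg(x
+ s y)`. -/
theorem integral_ballWeight_smul_fderiv_eq_zero {g : E → F} (hg : ContDiff ℝ 2 g) {x : E} {s R : ℝ}
    (hs : 0 ≤ s) (hsR : s ≤ R) (hΔ : ∀ y ∈ Metric.closedBall x R, Laplacian.laplacian g y = 0) :
    ∫ y, ballWeight y • fderiv ℝ g (x + s • y) y ∂μ = 0 := by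
  let b := stdOrthonormalBasis ℝ E
  have hg1 : ContDiff ℝ 1 (fderiv ℝ g) := hg.fderiv_right (by norm_num)
  have hg1c : Continuous (fderiv ℝ g) := hg1.continuous
  have hg2c : Continuous (fderiv ℝ (fderiv ℝ g)) := hg1.continuous_fderiv one_ne_zero
  have hw := continuous_ballWeight (E := E)
  have hcs := hasCompactSupport_ballWeight (E := E)
  have hsq : HasCompactSupport fun y : E => ballWeight y ^ 2 := by
    simpa [pow_two] using! hcs.mul_left (f := ballWeight)
  have hfd : ∀ y v : E, fderiv ℝ (fun y : E => ballWeight y ^ 2) y v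
      = -(4 * ballWeight y) * inner ℝ y v := fun y v => by
    rw [(hasFDerivAt_ballWeight_sq y).fderiv]; simp
  have hG : ∀ v y : E, HasFDerivAt (fun y => fderiv ℝ g (x + s • y) v)
      (s • (ContinuousLinearMap.apply ℝ F v).comp (fderiv ℝ (fderiv ℝ g) (x + s • y))) y := by
    intro v y
    have h1 : HasFDerivAt (fun y : E => x + s • y) (s • ContinuousLinearMap.id ℝ E) y :=
      ((hasFDerivAt_id y).const_smul s).const_add x
    have h2 := ((hg1.differentiable one_ne_zero).differentiableAt (x := x + s • y)).hasFDerivAt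
    have h3 := ((ContinuousLinearMap.apply ℝ F v).hasFDerivAt
      (x := fderiv ℝ g (x + s • y))).comp y (h2.comp y h1)
    refine h3.congr_fderiv ?_
    ext w
    simp
  have hparts : ∀ v : E, ∫ y, (ballWeight y * inner ℝ y v) • fderiv ℝ g (x + s • y) v ∂μ
      = (s / 4) • ∫ y, ballWeight y ^ 2 • fderiv ℝ (fderiv ℝ g) (x + s • y) v v ∂μ := by
    intro v
    have key := integral_smul_fderiv_eq_neg_fderiv_smul_of_integrable (μ := μ)
      (f := fun y : E => ballWeight y ^ 2) (g := fun y => fderiv ℝ g (x + s • y) v) (v := v)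
      ?_ ?_ ?_ (fun y _ => (hasFDerivAt_ballWeight_sq y).differentiableAt)
      (fun y _ => (hG v y).differentiableAt)
    · simp only [hfd, (hG v _).fderiv, smul_apply,
        ContinuousLinearMap.comp_apply, ContinuousLinearMap.apply_apply] at key
      have e1 : ∀ y : E, ballWeight y ^ 2 • s • fderiv ℝ (fderiv ℝ g) (x + s • y) v v
          = s • ballWeight y ^ 2 • fderiv ℝ (fderiv ℝ g) (x + s • y) v v :=
        fun y => smul_comm _ _ _
      have e2 : ∀ y : E, (-(4 * ballWeight y) * inner ℝ y v) • fderiv ℝ g (x + s • y) v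
          = (-4 : ℝ) • (ballWeight y * inner ℝ y v) • fderiv ℝ g (x + s • y) v := fun y => by
        rw [smul_smul]; congr 1; ring
      simp only [e1, e2, integral_smul] at key
      rw [div_eq_inv_mul, mul_smul, key, ← neg_smul, smul_smul]
      norm_num
    · simp only [hfd]
      refine Continuous.integrable_of_hasCompactSupport (by fun_prop) ?_
      exact ((hcs.mul_left (f := fun _ => 4)).neg.mul_right).smul_right
    · simp only [(hG v _).fderiv]
      exact Continuous.integrable_of_hasCompactSupport (by fun_prop) hsq.smul_right
    · exact Continuous.integrable_of_hasCompactSupport (by fun_prop) hsq.smul_right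
  have hexp : ∀ y : E, ballWeight y • fderiv ℝ g (x + s • y) y
      = ∑ i, (ballWeight y * inner ℝ y (b i)) • fderiv ℝ g (x + s • y) (b i) := by
    intro y
    conv_lhs => rw [← b.sum_repr' y, map_sum, Finset.smul_sum]
    refine Finset.sum_congr rfl fun i _ => ?_
    rw [b.sum_repr' y, map_smul, smul_smul, real_inner_comm]
  simp only [hexp]
  rw [integral_finsetSum]
  · simp only [hparts]
    rw [← Finset.smul_sum, ← integral_finsetSum]
    · rw [integral_eq_zero_of_ae, smul_zero]
      refine Filter.Eventually.of_forall fun y => ?_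
      change ∑ i, ballWeight y ^ 2 • _ = (0 : F)
      rw [← Finset.smul_sum]
      by_cases hy : y ∈ Metric.closedBall (0 : E) 1
      · have hy' : x + s • y ∈ Metric.closedBall x R := by
          rw [mem_closedBall_zero_iff] at hy
          rw [mem_closedBall_iff_norm, add_sub_cancel_left, norm_smul, Real.norm_of_nonneg hs]
          nlinarith [norm_nonneg y]
        have := hΔ _ hy'
        rw [laplacian_eq_iteratedFDeriv_orthonormalBasis g b] at this
        simp only [iteratedFDeriv_two_apply] at this
        simpa using Or.inr this
      · simp [ballWeight_eq_zero hy]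
    · intro i _
      exact Continuous.integrable_of_hasCompactSupport (by fun_prop) hsq.smul_right
  · intro i _
    exact Continuous.integrable_of_hasCompactSupport (by fun_prop) hcs.mul_right.smul_right

variable [CompleteSpace F]

/-- The mean value property with the weight `(1 - ‖y‖²)₊`. -/
theorem integral_ballWeight_smul_eq {g : E → F} (hg : ContDiff ℝ 2 g) (hgc : HasCompactSupport g)
    {x : E} {R : ℝ} (hR : 0 ≤ R)
    (hΔ : ∀ y ∈ Metric.closedBall x R, Laplacian.laplacian g y = 0) :
    ∫ y, ballWeight y • g (x + R • y) ∂μ = (∫ y, ballWeight y ∂μ) • g x := by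
  have hgd : Continuous (fderiv ℝ g) := hg.continuous_fderiv two_ne_zero
  have hgcont := hg.continuous
  have hw := continuous_ballWeight (E := E)
  have hcs := hasCompactSupport_ballWeight (E := E)
  obtain ⟨M, hM⟩ := (hgc.fderiv (𝕜 := ℝ)).exists_bound_of_continuous hgd
  -- The weighted mean is constant for `s` in `[0, R]`, and at `s = 0` the value `g x` factors out.
  have hder : ∀ s : ℝ, HasDerivAt (fun s : ℝ => ∫ y, ballWeight y • g (x + s • y) ∂μ)
      (∫ y, ballWeight y • fderiv ℝ g (x + s • y) y ∂μ) s := by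
    intro s
    refine (hasDerivAt_integral_of_dominated_loc_of_deriv_le (s := Set.univ)
      (F := fun s y => ballWeight y • g (x + s • y))
      (F' := fun s y => ballWeight y • fderiv ℝ g (x + s • y) y)
      (bound := fun y => ballWeight y * (M * ‖y‖)) Filter.univ_mem ?_ ?_ ?_ ?_ ?_ ?_).2
    · refine Filter.Eventually.of_forall fun s => ?_
      exact (by fun_prop : Continuous fun y => ballWeight y • g (x + s • y)).aestronglyMeasurable
    · exact Continuous.integrable_of_hasCompactSupport (by fun_prop) hcs.smul_right
    · exact (by fun_prop : Continuous fun y =>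
        ballWeight y • fderiv ℝ g (x + s • y) y).aestronglyMeasurable
    · refine Filter.Eventually.of_forall fun y s _ => ?_
      rw [norm_smul, Real.norm_of_nonneg (ballWeight_nonneg y)]
      exact mul_le_mul_of_nonneg_left ((fderiv ℝ g (x + s • y)).le_of_opNorm_le (hM _) y)
        (ballWeight_nonneg y)
    · exact Continuous.integrable_of_hasCompactSupport (by fun_prop) hcs.mul_right
    · refine Filter.Eventually.of_forall fun y s _ => HasDerivAt.const_smul _ ?_
      have h1 : HasDerivAt (fun s : ℝ => x + s • y) y s := by
        simpa using ((hasDerivAt_id s).smul_const y).const_add x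
      exact ((hg.differentiable two_ne_zero).differentiableAt.hasFDerivAt).comp_hasDerivAt s h1
  have := constant_of_has_deriv_right_zero (a := 0) (b := R)
    (f := fun s : ℝ => ∫ y, ballWeight y • g (x + s • y) ∂μ)
    (fun s _ => (hder s).continuousAt.continuousWithinAt)
    (fun s hs => by
      have h := (hder s).hasDerivWithinAt (s := Set.Ici s)
      rwa [integral_ballWeight_smul_fderiv_eq_zero μ hg hs.1 hs.2.le hΔ] at h)
    R ⟨hR, le_rfl⟩
  simp only [zero_smul, add_zero] at this
  rw [this, integral_smul_const]

/-- A harmonic function is bounded at the centre of a ball by its average over a smaller one. -/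
theorem InnerProductSpace.HarmonicOnNhd.enorm_mul_le_lintegral {f : E → F} {x : E}
    {R : ℝ} (hR : 0 < R)
    (hf : HarmonicOnNhd f (Metric.ball x (2 * R))) :
    ENNReal.ofReal (∫ y, ballWeight y ∂μ) * ‖f x‖ₑ
      ≤ ∫⁻ y in Metric.closedBall (0 : E) 1, ‖f (x + R • y)‖ₑ ∂μ := by
  -- The cutoff equals 1 near the closed ball of radius `R` and is supported inside the domain of
  -- harmonicity, since `R < 3R/2 < 7R/4 < 2R`.
  let χ : ContDiffBump x := ⟨3 / 2 * R, 7 / 4 * R, by positivity, by linarith⟩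
  let g : E → F := fun y => χ y • f y
  have hg : ContDiff ℝ 2 g := by
    rw [contDiff_iff_contDiffAt]
    intro y
    by_cases hy : y ∈ Metric.ball x (2 * R)
    · exact χ.contDiffAt.smul (hf y hy).1
    · have hy' : y ∉ tsupport χ := by
        rw [χ.tsupport_eq, Metric.mem_closedBall]
        rw [Metric.mem_ball] at hy
        have : χ.rOut = 7 / 4 * R := rfl
        linarith
      refine (contDiffAt_const (c := (0 : F))).congr_of_eventuallyEq ?_
      filter_upwards [notMem_tsupport_iff_eventuallyEq.1 hy'] with z hz
      simp [g, hz]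
  have hgc : HasCompactSupport g := χ.hasCompactSupport.smul_right
  have heq : ∀ y ∈ Metric.closedBall x R, g =ᶠ[nhds y] f := by
    intro y hy
    have hy' : y ∈ Metric.ball x χ.rIn := by
      rw [Metric.mem_closedBall] at hy
      rw [Metric.mem_ball]
      have : χ.rIn = 3 / 2 * R := rfl
      linarith
    filter_upwards [χ.eventuallyEq_one_of_mem_ball hy'] with z hz
    simp [g, hz]
  have hmem : ∀ y ∈ Metric.closedBall x R, y ∈ Metric.ball x (2 * R) := fun y hy =>
    Metric.closedBall_subset_ball (by linarith) hy
  have hmv := integral_ballWeight_smul_eq μ hg hgc (x := x) hR.le fun y hy => by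
    rw [(laplacian_congr_nhds (heq y hy)).eq_of_nhds]
    exact (hf y (hmem y hy)).2.eq_of_nhds
  have hgx : g x = f x := (heq x (Metric.mem_closedBall_self hR.le)).eq_of_nhds
  calc ENNReal.ofReal (∫ y, ballWeight y ∂μ) * ‖f x‖ₑ
      = ‖∫ y, ballWeight y • g (x + R • y) ∂μ‖ₑ := by
        rw [hmv, enorm_smul, hgx, Real.enorm_of_nonneg (integral_ballWeight_pos μ).le]
    _ ≤ ∫⁻ y, ‖ballWeight y • g (x + R • y)‖ₑ ∂μ := enorm_integral_le_lintegral_enorm _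
    _ ≤ ∫⁻ y, (Metric.closedBall (0 : E) 1).indicator (fun y => ‖f (x + R • y)‖ₑ) y ∂μ := by
        refine lintegral_mono fun y => ?_
        by_cases hy : y ∈ Metric.closedBall (0 : E) 1
        · have hy' : x + R • y ∈ Metric.closedBall x R := by
            rw [mem_closedBall_zero_iff] at hy
            rw [mem_closedBall_iff_norm, add_sub_cancel_left, norm_smul, Real.norm_of_nonneg hR.le]
            nlinarith [norm_nonneg y]
          rw [Set.indicator_of_mem hy, (heq _ hy').eq_of_nhds, enorm_smul]
          refine mul_le_of_le_one_left zero_le ?_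
          rw [Real.enorm_of_nonneg (ballWeight_nonneg y)]
          exact ENNReal.ofReal_le_one.2 (ballWeight_le_one y)
        · simp [ballWeight_eq_zero hy]
    _ = _ := lintegral_indicator measurableSet_closedBall _

end MeanValue

/-! ### From the mean value to a bound on `|f|^p`. -/

section LpBounds

variable {E F : Type*} [NormedAddCommGroup E] [InnerProductSpace ℝ E] [FiniteDimensional ℝ E]
  [MeasurableSpace E] [BorelSpace E] [NormedAddCommGroup F]

/-- Hölder against the constant 1, raised to the power `p`. -/
theorem lintegral_enorm_rpow_le {α : Type*} [MeasurableSpace α] {ν : Measure α} {f : α → F}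
    (hf : AEStronglyMeasurable f ν) {p : ℝ} (hp : 1 ≤ p) :
    (∫⁻ a, ‖f a‖ₑ ∂ν) ^ p ≤ ν Set.univ ^ (p - 1) * ∫⁻ a, ‖f a‖ₑ ^ p ∂ν := by
  have hp0 : 0 < p := one_pos.trans_le hp
  have h := ENNReal.rpow_le_rpow
    (eLpNorm'_le_eLpNorm'_mul_rpow_measure_univ one_pos hp hf) hp0.le
  rw [ENNReal.mul_rpow_of_nonneg _ _ hp0.le, ← lintegral_rpow_enorm_eq_rpow_eLpNorm' hp0,
    ← ENNReal.rpow_mul, mul_comm] at h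
  have e : (1 / 1 - 1 / p) * p = p - 1 := by field_simp
  rw [e] at h
  simpa [eLpNorm'_eq_lintegral_enorm] using h

theorem setLIntegral_closedBall_comp_add_smul (μ : Measure E) [μ.IsAddHaarMeasure] (h : E → ℝ≥0∞)
    (x : E) {R : ℝ} (hR : 0 < R) :
    ENNReal.ofReal (R ^ Module.finrank ℝ E) *
        ∫⁻ y in Metric.closedBall (0 : E) 1, h (x + R • y) ∂μ
      = ∫⁻ y in Metric.closedBall x R, h y ∂μ := by
  have hpow : 0 < R ^ Module.finrank ℝ E := pow_pos hR _
  have hind : ∀ y : E, (Metric.closedBall (0 : E) 1).indicator (fun y => h (x + R • y)) y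
      = (Metric.closedBall x R).indicator h (x + R • y) := fun y => by
    have : y ∈ Metric.closedBall (0 : E) 1 ↔ x + R • y ∈ Metric.closedBall x R := by
      rw [mem_closedBall_zero_iff, mem_closedBall_iff_norm, add_sub_cancel_left, norm_smul,
        Real.norm_of_nonneg hR.le]
      exact (mul_le_iff_le_one_right hR).symm
    by_cases hy : y ∈ Metric.closedBall (0 : E) 1
    · rw [Set.indicator_of_mem hy, Set.indicator_of_mem (this.1 hy)]
    · rw [Set.indicator_of_notMem hy, Set.indicator_of_notMem (mt this.2 hy)]
  have hmap := lintegral_map_equiv (μ := μ)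
    (fun z => (Metric.closedBall x R).indicator h (x + z))
    (Homeomorph.smulOfNeZero R hR.ne').toMeasurableEquiv
  have hcoe : ⇑(Homeomorph.smulOfNeZero R hR.ne').toMeasurableEquiv = fun y : E => R • y := rfl
  rw [hcoe, Measure.map_addHaar_smul μ hR.ne', lintegral_smul_measure,
    lintegral_add_left_eq_self, lintegral_indicator measurableSet_closedBall] at hmap
  rw [← lintegral_indicator measurableSet_closedBall]
  simp only [hind]
  rw [← hmap, smul_eq_mul, ← mul_assoc, ← ENNReal.ofReal_mul hpow.le,
    abs_of_pos (inv_pos.2 hpow), mul_inv_cancel₀ hpow.ne', ENNReal.ofReal_one, one_mul]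

/-- `|f|^p` at the centre of a ball is controlled by its average, for harmonic `f`. -/
theorem exists_enorm_rpow_le_setLIntegral (F : Type*) [NormedAddCommGroup F] [NormedSpace ℝ F]
    [CompleteSpace F] (μ : Measure E) [μ.IsAddHaarMeasure] {p : ℝ} (hp : 1 ≤ p) :
    ∃ K : ℝ≥0, ∀ (f : E → F) (x : E) (R : ℝ), 0 < R → HarmonicOnNhd f (Metric.ball x (2 * R)) →
      ‖f x‖ₑ ^ p * ENNReal.ofReal (R ^ Module.finrank ℝ E)
        ≤ K * ∫⁻ y in Metric.closedBall x R, ‖f y‖ₑ ^ p ∂μ := by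
  have hp0 : 0 < p := one_pos.trans_le hp
  set I := ENNReal.ofReal (∫ y, ballWeight y ∂μ)
  have hI0 : I ≠ 0 := (ENNReal.ofReal_pos.2 (integral_ballWeight_pos μ)).ne'
  have hV : (μ.restrict (Metric.closedBall (0 : E) 1)) Set.univ ≠ ∞ := by
    rw [Measure.restrict_apply_univ]
    exact measure_closedBall_lt_top.ne
  -- `I` normalizes the weight and the volume factor comes from Hölder; neither depends on `f`, `x`
  -- or `R`.
  set K : ℝ≥0∞ := (I ^ p)⁻¹ * (μ.restrict (Metric.closedBall (0 : E) 1)) Set.univ ^ (p - 1)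
  have hIp : I ^ p ≠ 0 := by simp [ENNReal.rpow_eq_zero_iff, hI0, hp0.le]
  have hIp' : I ^ p ≠ ∞ := ENNReal.rpow_ne_top_of_nonneg hp0.le ENNReal.ofReal_ne_top
  have hK : K ≠ ∞ := ENNReal.mul_ne_top (ENNReal.inv_ne_top.2 hIp)
    (ENNReal.rpow_ne_top_of_nonneg (by linarith) hV)
  refine ⟨K.toNNReal, fun f x R hR hf => ?_⟩
  rw [ENNReal.coe_toNNReal hK, ← setLIntegral_closedBall_comp_add_smul μ _ x hR]
  have hmeas : AEStronglyMeasurable (fun y => f (x + R • y))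
      (μ.restrict (Metric.closedBall (0 : E) 1)) := by
    refine ContinuousOn.aestronglyMeasurable ?_ measurableSet_closedBall
    refine hf.continuousOn.comp (by fun_prop) fun y hy => ?_
    rw [mem_closedBall_zero_iff] at hy
    rw [mem_ball_iff_norm, add_sub_cancel_left, norm_smul, Real.norm_of_nonneg hR.le]
    nlinarith
  have h1 := ENNReal.rpow_le_rpow (HarmonicOnNhd.enorm_mul_le_lintegral μ hR hf) hp0.le
  rw [ENNReal.mul_rpow_of_nonneg _ _ hp0.le] at h1
  have h2 := h1.trans (lintegral_enorm_rpow_le hmeas hp)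
  have h3 : ‖f x‖ₑ ^ p ≤ K * ∫⁻ y in Metric.closedBall (0 : E) 1, ‖f (x + R • y)‖ₑ ^ p ∂μ := by
    rw [mul_assoc]
    rwa [← ENNReal.div_eq_inv_mul, ENNReal.le_div_iff_mul_le (.inl hIp) (.inl hIp'), mul_comm]
  calc _ ≤ _ := mul_le_mul_left h3 _
    _ = _ := by ring

end LpBounds

/-- Each factor other than `u i` absorbs one copy of `D` and becomes a finite constant. Finiteness
lets these constants leave the integral without any measurability of `u`. -/
theorem lintegral_prod_mul_pow_le {α ι : Type*} [MeasurableSpace α] [Fintype ι] [DecidableEq ι]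
    {ν : Measure α} (u : ι → α → ℝ≥0∞) (A : ι → ℝ≥0) (N : ι → ℝ≥0∞) (D : ℝ≥0∞) (i : ι)
    (hN : ∀ j, N j ≠ ∞) (hu : ∀ j a, u j a * D ≤ A j * N j) (hi : ∫⁻ a, u i a ∂ν ≤ N i) :
    (∫⁻ a, ∏ j, u j a ∂ν) * D ^ (Fintype.card ι - 1)
      ≤ (∏ j ∈ Finset.univ.erase i, A j : ℝ≥0) * ∏ j, N j := by
  have hcard : (Finset.univ.erase i).card = Fintype.card ι - 1 := by
    rw [Finset.card_erase_of_mem (Finset.mem_univ i), Finset.card_univ]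
  have hfin : ∏ j ∈ Finset.univ.erase i, (A j * N j) ≠ ∞ :=
    ENNReal.prod_ne_top fun j _ => ENNReal.mul_ne_top ENNReal.coe_ne_top (hN j)
  calc (∫⁻ a, ∏ j, u j a ∂ν) * D ^ (Fintype.card ι - 1)
      ≤ ∫⁻ a, (∏ j, u j a) * D ^ (Fintype.card ι - 1) ∂ν := lintegral_mul_const_le _ _
    _ ≤ ∫⁻ a, u i a * ∏ j ∈ Finset.univ.erase i, (A j * N j) ∂ν := by
        refine lintegral_mono fun a => ?_
        rw [← hcard, ← Finset.mul_prod_erase _ _ (Finset.mem_univ i), mul_assoc,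
          ← Finset.prod_const, ← Finset.prod_mul_distrib]
        exact mul_le_mul_right (Finset.prod_le_prod' fun j _ => hu j a) _
    _ = (∫⁻ a, u i a ∂ν) * ∏ j ∈ Finset.univ.erase i, (A j * N j) := lintegral_mul_const' _ _ hfin
    _ ≤ N i * ∏ j ∈ Finset.univ.erase i, (A j * N j) := mul_le_mul_left hi _
    _ = _ := by
        rw [← Finset.mul_prod_erase _ N (Finset.mem_univ i), Finset.prod_mul_distrib]
        push_cast
        ring

/-! ### Pointwise bound in the ball. -/

section Ball

variable {𝕜 : Type*} [RCLike 𝕜]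

theorem measurable_indicator_enorm_rpow {E F : Type*} [TopologicalSpace E] [MeasurableSpace E]
    [BorelSpace E] [NormedAddCommGroup F] {s : Set E} {f : E → F}
    (hf : ContinuousOn f s) (hs : MeasurableSet s) (p : ℝ) :
    Measurable (s.indicator fun x => ‖f x‖ₑ ^ p) := by
  classical
  rw [← Set.piecewise_eq_indicator]
  exact ContinuousOn.measurable_piecewise
    ((ENNReal.continuous_rpow_const.comp continuous_enorm).comp_continuousOn hf)
    continuousOn_const hs

theorem lintegral_le_ballHardyNorm_rpow {n : ℕ} {p : ℝ} (hp : 1 < p) (f : RealSpace n → 𝕜)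
    {r : ℝ} (hr : r ∈ Set.Ico (0 : ℝ) 1) :
    ∫⁻ ξ : UnitSphere n, ‖f (r • (ξ : RealSpace n))‖ₑ ^ p ∂(sphereMeasure n)
      ≤ ballHardyNorm n p f ^ p := by
  have h : (∫⁻ ξ : UnitSphere n, ‖f (r • (ξ : RealSpace n))‖ₑ ^ p ∂(sphereMeasure n)) ^ (1 / p)
      ≤ ballHardyNorm n p f := le_iSup₂ (f := fun (r : ℝ) (_ : r ∈ Set.Ico (0 : ℝ) 1) =>
        (∫⁻ ξ : UnitSphere n, ‖f (r • (ξ : RealSpace n))‖ₑ ^ p ∂(sphereMeasure n)) ^ (1 / p)) r hr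
  rwa [one_div, ENNReal.rpow_inv_le_iff (by linarith)] at h

/-- Polar coordinates miss only the origin, a null set since `E` is nontrivial. -/
theorem lintegral_eq_lintegral_toSphere {E : Type*} [NormedAddCommGroup E] [NormedSpace ℝ E]
    [FiniteDimensional ℝ E] [Nontrivial E] [MeasurableSpace E] [BorelSpace E] (μ : Measure E)
    [μ.IsAddHaarMeasure] {h : E → ℝ≥0∞} (hh : Measurable h) :
    ∫⁻ x, h x ∂μ = ∫⁻ s : Set.Ioi (0 : ℝ), ∫⁻ ξ : Metric.sphere (0 : E) 1, h (s.1 • ξ.1) ∂μ.toSphere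
      ∂(Measure.volumeIoiPow (Module.finrank ℝ E - 1)) := by
  have hmp := μ.measurePreserving_homeomorphUnitSphereProd.lintegral_comp_emb
    (Homeomorph.measurableEmbedding _)
    (fun q : Metric.sphere (0 : E) 1 × Set.Ioi (0 : ℝ) => h (q.2.1 • q.1.1))
  have hg : Measurable fun q : Metric.sphere (0 : E) 1 × Set.Ioi (0 : ℝ) => h (q.2.1 • q.1.1) := by
    refine hh.comp ?_
    exact (measurable_subtype_coe.comp measurable_snd).smul
      (measurable_subtype_coe.comp measurable_fst)
  rw [lintegral_prod_symm' _ hg] at hmp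
  have hself : ∀ x : ({0}ᶜ : Set E), h ((homeomorphUnitSphereProd E x).2.1 •
      (homeomorphUnitSphereProd E x).1.1) = h x := fun x => by
    congr 1
    have hx : ‖(x : E)‖ ≠ 0 := norm_ne_zero_iff.2 x.2
    simp [smul_smul, hx]
  simp only [hself] at hmp
  rw [← hmp, lintegral_subtype_comap (measurableSet_singleton (0 : E)).compl h,
    restrict_compl_singleton]

theorem isOpen_unitBall (n : ℕ) : IsOpen (unitBall n) := Metric.isOpen_ball

theorem ofReal_two_mul_pow (s : ℝ) (k : ℕ) :
    ENNReal.ofReal ((2 * s) ^ k) = 2 ^ k * ENNReal.ofReal (s ^ k) := by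
  rw [mul_pow, ENNReal.ofReal_mul (by positivity), ENNReal.ofReal_pow zero_le_two,
    ENNReal.ofReal_ofNat]

theorem sphereMeasure_smul (n : ℕ) (hn : 1 ≤ n) :
    (volume : Measure (RealSpace n)).toSphere
      = (volume : Measure (RealSpace n)).toSphere Set.univ • sphereMeasure n := by
  have : Nonempty (Fin n) := ⟨⟨0, hn⟩⟩
  rw [sphereMeasure, smul_smul, ENNReal.mul_inv_cancel, one_smul]
  · rw [Ne, Measure.measure_univ_eq_zero]
    exact Measure.toSphere_ne_zero _
  · exact measure_ne_top _ _

theorem exists_setLIntegral_unitBall_le (n : ℕ) (hn : 1 ≤ n) {p : ℝ} (hp : 1 < p) :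
    ∃ c : ℝ≥0, ∀ f : RealSpace n → 𝕜, MemBallHardy n p f →
      ∫⁻ x in unitBall n, ‖f x‖ₑ ^ p ≤ c * ballHardyNorm n p f ^ p := by
  have : Nonempty (Fin n) := ⟨⟨0, hn⟩⟩
  set T := (volume : Measure (RealSpace n)).toSphere Set.univ
  -- `T` undoes the normalization of the sphere measure; the other factor is the integral of `s ^ (n
  -- - 1)` over `(0, 1)`.
  set c : ℝ≥0∞ := T * Measure.volumeIoiPow (Module.finrank ℝ (RealSpace n) - 1)
    (Set.Iio ⟨1, Set.mem_Ioi.2 one_pos⟩)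
  have hc : c ≠ ∞ := by
    refine ENNReal.mul_ne_top (measure_ne_top _ _) ?_
    rw [Measure.volumeIoiPow_apply_Iio]
    exact ENNReal.ofReal_ne_top
  refine ⟨c.toNNReal, fun f hf => ?_⟩
  rw [ENNReal.coe_toNNReal hc, ← lintegral_indicator (isOpen_unitBall n).measurableSet,
    lintegral_eq_lintegral_toSphere volume
      (measurable_indicator_enorm_rpow hf.1.continuousOn (isOpen_unitBall n).measurableSet p)]
  calc _ ≤ ∫⁻ s : Set.Ioi (0 : ℝ), (Set.Iio ⟨1, Set.mem_Ioi.2 one_pos⟩).indicator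
        (fun _ => T * ballHardyNorm n p f ^ p) s
        ∂(Measure.volumeIoiPow (Module.finrank ℝ (RealSpace n) - 1)) := by
        refine lintegral_mono fun s => ?_
        by_cases hs : s.1 < 1
        · rw [Set.indicator_of_mem (show s ∈ Set.Iio ⟨1, Set.mem_Ioi.2 one_pos⟩ from hs),
            sphereMeasure_smul n hn, lintegral_smul_measure, smul_eq_mul]
          refine mul_le_mul_right (le_trans (lintegral_mono fun ξ => ?_)
            (lintegral_le_ballHardyNorm_rpow hp f ⟨s.2.le, hs⟩)) _
          exact Set.indicator_le_self _ _ _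
        · rw [Set.indicator_of_notMem (show s ∉ Set.Iio ⟨1, Set.mem_Ioi.2 one_pos⟩ from hs)]
          refine le_of_eq (lintegral_eq_zero_of_ae_eq_zero (Filter.Eventually.of_forall fun ξ => ?_))
          refine Set.indicator_of_notMem ?_ _
          rw [unitBall, mem_ball_zero_iff, norm_smul, norm_eq_of_mem_sphere ξ, mul_one,
            Real.norm_of_nonneg s.2.le]
          exact hs
    _ = c * ballHardyNorm n p f ^ p := by
        rw [lintegral_indicator measurableSet_Iio, setLIntegral_const]
        ring

/-- The integral over the small ball is crudely bounded by that over the whole unit ball, which is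
enough for the exponent `n`. The radius is half the distance to the sphere because harmonicity is
needed on the doubled ball, whence the factor `2 ^ n`. -/
theorem exists_enorm_rpow_mul_le_ballHardyNorm (n : ℕ) (hn : 1 ≤ n) {p : ℝ} (hp : 1 < p) :
    ∃ A : ℝ≥0, ∀ f : RealSpace n → 𝕜, MemBallHardy n p f → ∀ x : RealSpace n, ‖x‖ < 1 →
      ‖f x‖ₑ ^ p * ENNReal.ofReal ((1 - ‖x‖) ^ n) ≤ A * ballHardyNorm n p f ^ p := by
  obtain ⟨K, hK⟩ := exists_enorm_rpow_le_setLIntegral 𝕜 (volume : Measure (RealSpace n)) hp.le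
  obtain ⟨c, hc⟩ := exists_setLIntegral_unitBall_le (𝕜 := 𝕜) n hn hp
  refine ⟨2 ^ n * K * c, fun f hf x hx => ?_⟩
  have hsub : Metric.ball x (2 * ((1 - ‖x‖) / 2)) ⊆ unitBall n :=
    Metric.ball_subset_ball' (by rw [dist_zero_right]; linarith)
  have h1 := hK f x ((1 - ‖x‖) / 2) (by linarith) (hf.1.mono hsub)
  rw [finrank_euclideanSpace_fin] at h1
  have h2 : ENNReal.ofReal ((1 - ‖x‖) ^ n) = 2 ^ n * ENNReal.ofReal (((1 - ‖x‖) / 2) ^ n) := by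
    rw [← ofReal_two_mul_pow, mul_div_cancel₀ _ two_ne_zero]
  have h3 : ∫⁻ y in Metric.closedBall x ((1 - ‖x‖) / 2), ‖f y‖ₑ ^ p ≤ c * ballHardyNorm n p f ^ p :=
    (lintegral_mono_set
      ((Metric.closedBall_subset_ball (by linarith)).trans hsub)).trans (hc f hf)
  calc _ = 2 ^ n * (‖f x‖ₑ ^ p * ENNReal.ofReal (((1 - ‖x‖) / 2) ^ n)) := by rw [h2]; ring
    _ ≤ 2 ^ n * (K * (c * ballHardyNorm n p f ^ p)) :=
        mul_le_mul_right (h1.trans (mul_le_mul_right h3 _)) _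
    _ = _ := by push_cast; ring

end Ball

/-! ### Pointwise bound in the half space. -/

section HalfSpace

variable {𝕜 : Type*} [RCLike 𝕜]

theorem lintegral_le_halfSpaceHardyNorm_rpow {n : ℕ} {p : ℝ} (hp : 1 < p)
    (f : RealSpaceSucc n → 𝕜) {t : ℝ} (ht : 0 < t) :
    ∫⁻ x : RealSpace n, ‖f (WithLp.toLp 2 (x, t))‖ₑ ^ p ≤ halfSpaceHardyNorm n p f ^ p := by
  have h : (∫⁻ x : RealSpace n, ‖f (WithLp.toLp 2 (x, t))‖ₑ ^ p) ^ (1 / p)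
      ≤ halfSpaceHardyNorm n p f := le_iSup₂ (f := fun (t : ℝ) (_ : t ∈ Set.Ioi (0 : ℝ)) =>
        (∫⁻ x : RealSpace n, ‖f (WithLp.toLp 2 (x, t))‖ₑ ^ p) ^ (1 / p)) t ht
  rwa [one_div, ENNReal.rpow_inv_le_iff (by linarith)] at h

theorem abs_snd_sub_le {n : ℕ} (z w : RealSpaceSucc n) : |z.snd - w.snd| ≤ dist z w := by
  rw [WithLp.prod_dist_eq_of_L2, ← Real.dist_eq]
  exact Real.le_sqrt_of_sq_le (by nlinarith [sq_nonneg (dist z.fst w.fst)])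

/-- Fubini: each horizontal slice contributes at most the `p`-th power of the norm. Since `0 < a`,
the slab lies where `f` is continuous. -/
theorem setLIntegral_slab_le {n : ℕ} {p : ℝ} (hp : 1 < p) {f : RealSpaceSucc n → 𝕜}
    (hf : MemHalfSpaceHardy n p f) {a b : ℝ} (ha : 0 < a) :
    ∫⁻ z in {z : RealSpaceSucc n | z.snd ∈ Set.Icc a b}, ‖f z‖ₑ ^ p
      ≤ ENNReal.ofReal (b - a) * halfSpaceHardyNorm n p f ^ p := by
  have hs : MeasurableSet {z : RealSpaceSucc n | z.snd ∈ Set.Icc a b} :=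
    (isClosed_Icc.preimage (by fun_prop : Continuous fun z : RealSpaceSucc n => z.snd)).measurableSet
  have hmeas := measurable_indicator_enorm_rpow
    (hf.1.continuousOn.mono fun z hz => ha.trans_le hz.1) hs p
  rw [← lintegral_indicator hs,
    ← (WithLp.volume_preserving_toLp (RealSpace n) ℝ).lintegral_comp hmeas, Measure.volume_eq_prod,
    lintegral_prod_symm' _
      (hmeas.fun_comp (WithLp.volume_preserving_toLp (RealSpace n) ℝ).measurable)]
  calc _ ≤ ∫⁻ t : ℝ, (Set.Icc a b).indicator (fun _ => halfSpaceHardyNorm n p f ^ p) t := by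
        refine lintegral_mono fun t => ?_
        by_cases ht : t ∈ Set.Icc a b
        · rw [Set.indicator_of_mem ht]
          refine le_trans (lintegral_mono fun x => ?_)
            (lintegral_le_halfSpaceHardyNorm_rpow hp f (ha.trans_le ht.1))
          exact Set.indicator_le_self _ _ _
        · rw [Set.indicator_of_notMem ht]
          refine le_of_eq (lintegral_eq_zero_of_ae_eq_zero (Filter.Eventually.of_forall fun x => ?_))
          exact Set.indicator_of_notMem (s := {z : RealSpaceSucc n | z.snd ∈ Set.Icc a b}) ht _
    _ = _ := by
        rw [lintegral_indicator measurableSet_Icc, setLIntegral_const, Real.volume_Icc, mul_comm]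

theorem exists_enorm_rpow_mul_le_halfSpaceHardyNorm (n : ℕ) {p : ℝ} (hp : 1 < p) :
    ∃ A : ℝ≥0, ∀ f : RealSpaceSucc n → 𝕜, MemHalfSpaceHardy n p f → ∀ (x : RealSpace n) (t : ℝ),
      0 < t → ‖f (WithLp.toLp 2 (x, t))‖ₑ ^ p * ENNReal.ofReal (t ^ n)
        ≤ A * halfSpaceHardyNorm n p f ^ p := by
  obtain ⟨K, hK⟩ := exists_enorm_rpow_le_setLIntegral 𝕜 (volume : Measure (RealSpaceSucc n)) hp.le
  refine ⟨2 ^ (n + 1) * K, fun f hf x t ht => ?_⟩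
  set z : RealSpaceSucc n := WithLp.toLp 2 (x, t)
  have hsub : Metric.ball z (2 * (t / 2)) ⊆ upperHalfSpace n := fun w hw => by
    have h := (abs_lt.1 ((abs_snd_sub_le w z).trans_lt hw)).1
    change 0 < w.snd
    change -(2 * (t / 2)) < w.snd - t at h
    linarith
  have hslab : Metric.closedBall z (t / 2)
      ⊆ {w : RealSpaceSucc n | w.snd ∈ Set.Icc (t / 2) (t / 2 + t)} := fun w hw => by
    have h := abs_le.1 ((abs_snd_sub_le w z).trans hw)
    change -(t / 2) ≤ w.snd - t ∧ w.snd - t ≤ t / 2 at h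
    exact ⟨by linarith, by linarith⟩
  have h1 := hK f z (t / 2) (by positivity) (hf.1.mono hsub)
  have hdim : Module.finrank ℝ (RealSpaceSucc n) = n + 1 := by
    rw [(WithLp.linearEquiv 2 ℝ (RealSpace n × ℝ)).finrank_eq]
    simp
  have h2 : ENNReal.ofReal t * ENNReal.ofReal (t ^ n)
      = 2 ^ (n + 1) * ENNReal.ofReal ((t / 2) ^ (n + 1)) := by
    rw [← ofReal_two_mul_pow, mul_div_cancel₀ _ two_ne_zero, pow_succ',
      ENNReal.ofReal_mul ht.le]
  have h3 := (lintegral_mono_set (μ := volume) (f := fun z => ‖f z‖ₑ ^ p) hslab).trans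
    (setLIntegral_slab_le hp hf (half_pos ht))
  rw [add_sub_cancel_left] at h3
  rw [hdim] at h1
  -- Multiplying by `t` produces the power `t ^ (n + 1)` of the solid ball; on the other side this
  -- `t` is the thickness of the slab.
  rw [← ENNReal.mul_le_mul_iff_right (a := ENNReal.ofReal t) (ENNReal.ofReal_pos.2 ht).ne'
    ENNReal.ofReal_ne_top]
  calc _ = 2 ^ (n + 1) * (‖f z‖ₑ ^ p * ENNReal.ofReal ((t / 2) ^ (n + 1))) := by
        rw [mul_left_comm, h2]; ring
    _ ≤ 2 ^ (n + 1) * (K * (ENNReal.ofReal t * halfSpaceHardyNorm n p f ^ p)) :=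
        mul_le_mul_right (h1.trans (mul_le_mul_right h3 _)) _
    _ = _ := by push_cast; ring

end HalfSpace

/-! ### The product estimates. -/

theorem mainTheorem10 {𝕜 : Type*} [RCLike 𝕜] (n m : ℕ) (hn : 1 ≤ n) (hm : 1 ≤ m)
    (p : Fin m → ℝ) (hp : ∀ j, 1 < p j) :
    (∃ C : ℝ≥0, ∀ f : Fin m → RealSpace n → 𝕜, (∀ j, MemBallHardy n (p j) (f j)) →
      ∀ r : ℝ, 0 ≤ r → r < 1 →
        (∫⁻ ξ : UnitSphere n, ∏ j, ‖f j (r • (ξ : RealSpace n))‖ₑ ^ p j ∂(sphereMeasure n)) *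
            ENNReal.ofReal ((1 - r) ^ ((m - 1) * n)) ≤
          C * ∏ j, ballHardyNorm n (p j) (f j) ^ p j) ∧
    (∃ C : ℝ≥0, ∀ f : Fin m → RealSpaceSucc n → 𝕜, (∀ j, MemHalfSpaceHardy n (p j) (f j)) →
      ∀ t : ℝ, 0 < t →
        (∫⁻ x : RealSpace n, ∏ j, ‖f j (WithLp.toLp 2 (x, t))‖ₑ ^ p j) *
            ENNReal.ofReal (t ^ ((m - 1) * n)) ≤
          C * ∏ j, halfSpaceHardyNorm n (p j) (f j) ^ p j) := by
  have hp0 : ∀ j, 0 ≤ p j := fun j => (one_pos.trans (hp j)).le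
  constructor
  · choose A hA using fun j => exists_enorm_rpow_mul_le_ballHardyNorm (𝕜 := 𝕜) n hn (hp j)
    -- The factor of index 0 is the one integrated, so its pointwise constant does not enter.
    refine ⟨∏ j ∈ Finset.univ.erase ⟨0, hm⟩, A j, fun f hf r hr0 hr1 => ?_⟩
    have h := lintegral_prod_mul_pow_le (ν := sphereMeasure n)
      (fun j (ξ : UnitSphere n) => ‖f j (r • (ξ : RealSpace n))‖ₑ ^ p j) A
      (fun j => ballHardyNorm n (p j) (f j) ^ p j) (ENNReal.ofReal ((1 - r) ^ n)) ⟨0, hm⟩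
      (fun j => ENNReal.rpow_ne_top_of_nonneg (hp0 j) (hf j).2.ne)
      (fun j ξ => by
        have hξ : ‖r • (ξ : RealSpace n)‖ = r := by
          rw [norm_smul, norm_eq_of_mem_sphere ξ, mul_one, Real.norm_of_nonneg hr0]
        simpa only [hξ] using hA j (f j) (hf j) (r • (ξ : RealSpace n)) (hξ.trans_lt hr1))
      (lintegral_le_ballHardyNorm_rpow (hp _) _ ⟨hr0, hr1⟩)
    rwa [Fintype.card_fin, ← ENNReal.ofReal_pow (pow_nonneg (by linarith) _), ← pow_mul,
      mul_comm n] at h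
  · choose A hA using fun j => exists_enorm_rpow_mul_le_halfSpaceHardyNorm (𝕜 := 𝕜) n (hp j)
    refine ⟨∏ j ∈ Finset.univ.erase ⟨0, hm⟩, A j, fun f hf t ht => ?_⟩
    have h := lintegral_prod_mul_pow_le (ν := (volume : Measure (RealSpace n)))
      (fun j x => ‖f j (WithLp.toLp 2 (x, t))‖ₑ ^ p j) A
      (fun j => halfSpaceHardyNorm n (p j) (f j) ^ p j) (ENNReal.ofReal (t ^ n)) ⟨0, hm⟩
      (fun j => ENNReal.rpow_ne_top_of_nonneg (hp0 j) (hf j).2.ne)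
      (fun j x => hA j (f j) (hf j) x t ht)
      (lintegral_le_halfSpaceHardyNorm_rpow (hp _) _ ht)
    rwa [Fintype.card_fin, ← ENNReal.ofReal_pow (pow_nonneg ht.le _), ← pow_mul, mul_comm n] at h
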